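/- Let $k$ be a positive integer and let $R$ be a commutative ring with $1$. Let $\Lambda$ be a $k$-graph, that is, a countable small category (objects are called vertices, morphisms $\lambda$ are called paths, with source $s(\lambda)$ and range $r(\lambda)$; $\lambda\mu$ is defined when $s(\lambda)=r(\mu)$) with a degree functor $d:\Lambda\to\mathbb{N}^k$ such that whenever $d(\lambda)=m+n$ there are unique paths $\mu,\nu$ with $\lambda=\mu\nu$, $d(\mu)=m$ and $d(\nu)=n$. Write $v\Lambda^n$ for the set of paths of range $v$ and degree $n$, and suppose that $\Lambda$ is row-finite with no sources: $v\Lambda^n$ is finite and nonempty for every vertex $v$ and every $n\in\mathbb{N}^k$. The Kumjian-Pask algebra $\mathrm{KP}_R(\Lambda)$ is the universal (associative, not necessarily unital) $R$-algebra generated by elements $p_v$ for the vertices $v$, and $s_\lambda$, $s_{\lambda^*}$ for the paths $\lambda$ with $d(\lambda)\neq 0$, subject to the following relations, in which $\lambda,\mu$ are paths of nonzero degree: 1. the $p_v$ are mutually orthogonal idempotents; 2. $s_\lambda s_\mu=s_{\lambda\mu}$ and $s_{\mu^*}s_{\lambda^*}=s_{(\lambda\mu)^*}$ if $r(\mu)=s(\lambda)$;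 $p_{r(\lambda)}s_\lambda=s_\lambda=s_\lambda p_{s(\lambda)}$ and $p_{s(\lambda)}s_{\lambda^*}=s_{\lambda^*}=s_{\lambda^*}p_{r(\lambda)}$; 3. $s_{\lambda^*}s_\mu=\delta_{\lambda,\mu}\,p_{s(\lambda)}$ if $d(\lambda)=d(\mu)$; 4. $p_v=\sum_{\lambda\in v\Lambda^n}s_\lambda s_{\lambda^*}$ for every vertex $v$ and every $n\in\mathbb{N}^k\setminus\{0\}$. Put $s_v=s_{v^*}=p_v$ for the paths of degree $0$, which are the vertices (identity morphisms). A pair of paths $(\alpha,\beta)$ with $s(\alpha)=s(\beta)$ is a cycline pair if $s_{\alpha\gamma}s_{(\alpha\gamma)^*}=s_{\beta\gamma}s_{(\beta\gamma)^*}$ for every path $\gamma$ with $r(\gamma)=s(\alpha)$. The cycline subalgebra $\mathcal{M}$ is the $R$-subalgebra of $\mathrm{KP}_R(\Lambda)$ (not required to contain a unit) generated by the elements $s_\alpha s_{\beta^*}$ with $(\alpha,\beta)$ a cycline pair. Then the center $$\mathcal{Z}(\mathrm{KP}_R(\Lambda)):=\{a\in \mathrm{KP}_R(\Lambda): ax=xa\text{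 for every }x\in \mathrm{KP}_R(\Lambda)\}$$ is contained in $\mathcal{M}$. -/

import Mathlib

open CategoryTheory

universe v u w

/-- A `k`-graph: a countable small category `Λ` together with a degree functor to the additive
monoid `ℕ^k` that has the unique factorization property.  A morphism `f : x ⟶ y` is a path with
source `x` and range `y`, so the composite path `λμ` (defined when `s(λ) = r(μ)`) is `μ ≫ λ`. -/
structure KGraph (k : ℕ) (Λ : Type u) [Category.{v} Λ] where
  /-- The degree map. -/
  d : ∀ {x y : Λ}, (x ⟶ y) → (Fin k → ℕ)
  d_id : ∀ x : Λ, d (𝟙 x) = 0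
  d_comp : ∀ {x y z : Λ} (f : x ⟶ y) (g : y ⟶ z), d (f ≫ g) = d f + d g
  /-- If `d(f) = m + n`, then `f = μν` for unique paths `μ`, `ν` of degrees `m`, `n`. -/
  unique_factorization : ∀ {x z : Λ} (f : x ⟶ z) (m n : Fin k → ℕ), d f = m + n →
    ∃! p : (Σ y : Λ, (y ⟶ z) × (x ⟶ y)), d p.2.1 = m ∧ d p.2.2 = n ∧ p.2.2 ≫ p.2.1 = f
  countable_vertices : Countable Λ
  countable_paths : ∀ x y : Λ, Countable (x ⟶ y)

namespace KGraph

variable {k : ℕ} {Λ : Type u} [Category.{v} Λ]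

/-- The paths of a `k`-graph: all morphisms, bundled with their source and range. -/
structure Path (Λ : Type u) [Category.{v} Λ] where
  source : Λ
  range : Λ
  hom : source ⟶ range

/-- A morphism as a path. -/
abbrev Path.of {x y : Λ} (f : x ⟶ y) : Path Λ := ⟨x, y, f⟩

/-- The set `vΛⁿ` of paths of degree `n` and range `v`. -/
def pathsTo (G : KGraph k Λ) (v : Λ) (n : Fin k → ℕ) : Set (Path Λ) :=
  {p | p.range = v ∧ G.d p.hom = n}

/-- `Λ` is row-finite if every set `vΛⁿ` is finite. -/
class RowFinite (G : KGraph k Λ) : Prop where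
  finite_pathsTo : ∀ (v : Λ) (n : Fin k → ℕ), (G.pathsTo v n).Finite

/-- `Λ` has no sources if every set `vΛⁿ` is nonempty. -/
class NoSources (G : KGraph k Λ) : Prop where
  nonempty_pathsTo : ∀ (v : Λ) (n : Fin k → ℕ), (G.pathsTo v n).Nonempty

/-- The set `vΛⁿ` as a finite set. -/
noncomputable def pathsToFinset (G : KGraph k Λ) [G.RowFinite] (v : Λ) (n : Fin k → ℕ) :
    Finset (Path Λ) :=
  (RowFinite.finite_pathsTo (G := G) v n).toFinset

open Classical in
/-- Kumjian-Pask `Λ`-families in a (not necessarily unital) ring `A`: idempotents `P v` for the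
vertices, and elements `S f`, `T f` for each path `f` and its ghost path `f*`, where by convention
`S` and `T` agree with `P` on the paths of degree zero, which are the identities `𝟙 v`. -/
structure IsKumjianPaskFamily (G : KGraph k Λ) [G.RowFinite] {A : Type*} [NonUnitalRing A]
    (P : Λ → A) (S T : Path Λ → A) : Prop where
  path_vertex : ∀ v : Λ, S (Path.of (𝟙 v)) = P v
  ghost_vertex : ∀ v : Λ, T (Path.of (𝟙 v)) = P v
  kp1 : ∀ v w : Λ, P v * P w = if v = w then P v else 0
  kp2_path : ∀ {x y z : Λ} (l : y ⟶ z) (m : x ⟶ y), G.d l ≠ 0 → G.d m ≠ 0 →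
    S (Path.of l) * S (Path.of m) = S (Path.of (m ≫ l))
  kp2_ghost : ∀ {x y z : Λ} (l : y ⟶ z) (m : x ⟶ y), G.d l ≠ 0 → G.d m ≠ 0 →
    T (Path.of m) * T (Path.of l) = T (Path.of (m ≫ l))
  kp2_range_path : ∀ l : Path Λ, G.d l.hom ≠ 0 → P l.range * S l = S l
  kp2_path_source : ∀ l : Path Λ, G.d l.hom ≠ 0 → S l * P l.source = S l
  kp2_source_ghost : ∀ l : Path Λ, G.d l.hom ≠ 0 → P l.source * T l = T l
  kp2_ghost_range : ∀ l : Path Λ, G.d l.hom ≠ 0 → T l * P l.range = T l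
  kp3 : ∀ l m : Path Λ, G.d l.hom ≠ 0 → G.d l.hom = G.d m.hom →
    T l * S m = if l = m then P l.source else 0
  kp4 : ∀ (v : Λ) (n : Fin k → ℕ), n ≠ 0 → P v = ∑ l ∈ G.pathsToFinset v n, S l * T l

/-- The generators of the Kumjian-Pask algebra: vertices, paths and ghost paths. -/
inductive Gen (Λ : Type u) [Category.{v} Λ] : Type (max u v)
  | vertex (x : Λ) : Gen Λ
  | path (p : Path Λ) : Gen Λ
  | ghost (p : Path Λ) : Gen Λ

/-- The free (associative, non-unital) `R`-algebra on the generators: the algebra of nonempty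
words in vertices, paths and ghost paths. -/
abbrev FreeAlg (R : Type w) [CommRing R] (Λ : Type u) [Category.{v} Λ] : Type (max u v w) :=
  MonoidAlgebra R (FreeSemigroup (Gen Λ))

/-- A generator, as an element of the free algebra. -/
noncomputable def gen (R : Type w) [CommRing R] (g : Gen Λ) : FreeAlg R Λ :=
  MonoidAlgebra.single (FreeSemigroup.of g) 1

open Classical Gen in
/-- The Kumjian-Pask relations in the free algebra, and their scalar multiples. -/
inductive Rel (R : Type w) [CommRing R] (G : KGraph k Λ) [G.RowFinite] :
    FreeAlg R Λ → FreeAlg R Λ → Prop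
  | path_vertex (v : Λ) : Rel R G (gen R (path (Path.of (𝟙 v)))) (gen R (vertex v))
  | ghost_vertex (v : Λ) : Rel R G (gen R (ghost (Path.of (𝟙 v)))) (gen R (vertex v))
  | kp1 (v w : Λ) : Rel R G (gen R (vertex v) * gen R (vertex w))
      (if v = w then gen R (vertex v) else 0)
  | kp2_path {x y z : Λ} (l : y ⟶ z) (m : x ⟶ y) : G.d l ≠ 0 → G.d m ≠ 0 →
      Rel R G (gen R (path (Path.of l)) * gen R (path (Path.of m)))
        (gen R (path (Path.of (m ≫ l))))
  | kp2_ghost {x y z : Λ} (l : y ⟶ z) (m : x ⟶ y) : G.d l ≠ 0 → G.d m ≠ 0 →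
      Rel R G (gen R (ghost (Path.of m)) * gen R (ghost (Path.of l)))
        (gen R (ghost (Path.of (m ≫ l))))
  | kp2_range_path (l : Path Λ) : G.d l.hom ≠ 0 →
      Rel R G (gen R (vertex l.range) * gen R (path l)) (gen R (path l))
  | kp2_path_source (l : Path Λ) : G.d l.hom ≠ 0 →
      Rel R G (gen R (path l) * gen R (vertex l.source)) (gen R (path l))
  | kp2_source_ghost (l : Path Λ) : G.d l.hom ≠ 0 →
      Rel R G (gen R (vertex l.source) * gen R (ghost l)) (gen R (ghost l))
  | kp2_ghost_range (l : Path Λ) : G.d l.hom ≠ 0 →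
      Rel R G (gen R (ghost l) * gen R (vertex l.range)) (gen R (ghost l))
  | kp3 (l m : Path Λ) : G.d l.hom ≠ 0 → G.d l.hom = G.d m.hom →
      Rel R G (gen R (ghost l) * gen R (path m)) (if l = m then gen R (vertex l.source) else 0)
  | kp4 (v : Λ) (n : Fin k → ℕ) : n ≠ 0 →
      Rel R G (gen R (vertex v)) (∑ l ∈ G.pathsToFinset v n, gen R (path l) * gen R (ghost l))
  | smul (r : R) {a b : FreeAlg R Λ} : Rel R G a b → Rel R G (r • a) (r • b)

/-- The congruence on the free algebra generated by the Kumjian-Pask relations. -/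
noncomputable def kpCon (R : Type w) [CommRing R] (G : KGraph k Λ) [G.RowFinite] : RingCon (FreeAlg R Λ) :=
  ringConGen (Rel R G)

theorem kpCon_smul (R : Type w) [CommRing R] (G : KGraph k Λ) [G.RowFinite] (r : R)
    {a b : FreeAlg R Λ} (h : kpCon R G a b) : kpCon R G (r • a) (r • b) := by
  change RingConGen.Rel (Rel R G) a b at h
  change RingConGen.Rel (Rel R G) (r • a) (r • b)
  induction h with
  | of x y h => exact .of _ _ (.smul r h)
  | refl x => exact .refl _
  | symm _ ih => exact .symm ih
  | trans _ _ ih₁ ih₂ => exact .trans ih₁ ih₂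
  | add _ _ ih₁ ih₂ => rw [smul_add, smul_add]; exact .add ih₁ ih₂
  | mul _ h₂ ih₁ ih₂ => rw [← smul_mul_assoc, ← smul_mul_assoc]; exact .mul ih₁ h₂

/-- The Kumjian-Pask algebra `KP_R(Λ)`: the (not necessarily unital) `R`-algebra given by the
generators and relations of a Kumjian-Pask `Λ`-family. -/
def KumjianPask (R : Type w) [CommRing R] (G : KGraph k Λ) [G.RowFinite] : Type (max u v w) :=
  (kpCon R G).Quotient

namespace KumjianPask

variable (R : Type w) [CommRing R] (G : KGraph k Λ) [G.RowFinite]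

noncomputable instance : NonUnitalRing (KumjianPask R G) :=
  inferInstanceAs (NonUnitalRing (kpCon R G).Quotient)

/-- The quotient map from the free algebra. -/
noncomputable def mk (a : FreeAlg R Λ) : KumjianPask R G := (a : (kpCon R G).Quotient)

theorem mk_surjective : Function.Surjective (mk R G) := Quotient.mk''_surjective

theorem mk_add (a b : FreeAlg R Λ) : mk R G (a + b) = mk R G a + mk R G b := rfl

theorem mk_mul (a b : FreeAlg R Λ) : mk R G (a * b) = mk R G a * mk R G b := rfl

theorem mk_zero : mk R G 0 = 0 := rfl

theorem mk_rel {a b : FreeAlg R Λ} (h : Rel R G a b) : mk R G a = mk R G b :=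
  (RingCon.eq (kpCon R G)).2 (RingConGen.Rel.of _ _ h)

noncomputable instance : SMul R (KumjianPask R G) where
  smul r := Quotient.map (fun a : FreeAlg R Λ => r • a) fun _ _ h => kpCon_smul R G r h

theorem mk_smul (r : R) (a : FreeAlg R Λ) : mk R G (r • a) = r • mk R G a := rfl

/-- The quotient map as an additive homomorphism. -/
noncomputable def mkAddHom : FreeAlg R Λ →+ KumjianPask R G where
  toFun := mk R G
  map_zero' := rfl
  map_add' _ _ := rfl

noncomputable instance : Module R (KumjianPask R G) :=
  Function.Surjective.module R (mkAddHom R G) (mk_surjective R G) (mk_smul R G)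

instance : IsScalarTower R (KumjianPask R G) (KumjianPask R G) where
  smul_assoc r x y := by
    obtain ⟨a, rfl⟩ := mk_surjective R G x
    obtain ⟨b, rfl⟩ := mk_surjective R G y
    simp only [smul_eq_mul, ← mk_smul, ← mk_mul, smul_mul_assoc]

instance : SMulCommClass R (KumjianPask R G) (KumjianPask R G) where
  smul_comm r x y := by
    obtain ⟨a, rfl⟩ := mk_surjective R G x
    obtain ⟨b, rfl⟩ := mk_surjective R G y
    simp only [smul_eq_mul, ← mk_smul, ← mk_mul, mul_smul_comm]

/-- The quotient map as a homomorphism of non-unital algebras. -/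
noncomputable def mkHom : FreeAlg R Λ →ₙₐ[R] KumjianPask R G where
  toFun := mk R G
  map_smul' := mk_smul R G
  map_zero' := rfl
  map_add' _ _ := rfl
  map_mul' _ _ := rfl

variable {R}

/-- The vertex idempotent `p_v`. -/
noncomputable def p (v : Λ) : KumjianPask R G := mk R G (gen R (.vertex v))

/-- The generator `s_f` of a path `f`, with `s_v = p_v`. -/
noncomputable def s (f : Path Λ) : KumjianPask R G := mk R G (gen R (.path f))

/-- The generator `s_{f*}` of the ghost path `f*`, with `s_{v*} = p_v`. -/
noncomputable def sGhost (f : Path Λ) : KumjianPask R G := mk R G (gen R (.ghost f))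

variable (R)

open Classical in
/-- The generators of `KP_R(Λ)` form a Kumjian-Pask family. -/
theorem isKumjianPaskFamily :
    G.IsKumjianPaskFamily (A := KumjianPask R G) (p G) (s G) (sGhost G) where
  path_vertex v := mk_rel R G (.path_vertex v)
  ghost_vertex v := mk_rel R G (.ghost_vertex v)
  kp1 v w := (mk_rel R G (.kp1 v w)).trans (apply_ite _ _ _ _)
  kp2_path l m hl hm := mk_rel R G (.kp2_path l m hl hm)
  kp2_ghost l m hl hm := mk_rel R G (.kp2_ghost l m hl hm)
  kp2_range_path l hl := mk_rel R G (.kp2_range_path l hl)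
  kp2_path_source l hl := mk_rel R G (.kp2_path_source l hl)
  kp2_source_ghost l hl := mk_rel R G (.kp2_source_ghost l hl)
  kp2_ghost_range l hl := mk_rel R G (.kp2_ghost_range l hl)
  kp3 l m hl hlm := (mk_rel R G (.kp3 l m hl hlm)).trans (apply_ite _ _ _ _)
  kp4 v n hn := (mk_rel R G (.kp4 v n hn)).trans (map_sum (mkAddHom R G) _ _)

/-- The universal property of `KP_R(Λ)`. -/
theorem existsUnique_lift {A : Type*} [NonUnitalRing A] [Module R A] [IsScalarTower R A A]
    [SMulCommClass R A A] {P : Λ → A} {S T : Path Λ → A} (h : G.IsKumjianPaskFamily P S T) :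
    ∃! φ : KumjianPask R G →ₙₐ[R] A,
      (∀ v, φ (p G v) = P v) ∧ (∀ f, φ (s G f) = S f) ∧ ∀ f, φ (sGhost G f) = T f := by
  classical
  let g : Gen Λ → A := fun x => match x with
    | .vertex v => P v
    | .path f => S f
    | .ghost f => T f
  let ψ : FreeAlg R Λ →ₙₐ[R] A := MonoidAlgebra.liftMagma R (FreeSemigroup.lift g)
  have hψ : ∀ x, ψ (gen R x) = g x := fun x => by
    simp [ψ, gen, MonoidAlgebra.liftMagma]
  have hrel : ∀ a b, Rel R G a b → ψ a = ψ b := by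
    intro a b hab
    induction hab with
    | path_vertex v => simpa [hψ] using h.path_vertex v
    | ghost_vertex v => simpa [hψ] using h.ghost_vertex v
    | kp1 v w => rw [apply_ite ψ]; simpa [hψ] using h.kp1 v w
    | kp2_path l m hl hm => simpa [hψ] using h.kp2_path l m hl hm
    | kp2_ghost l m hl hm => simpa [hψ] using h.kp2_ghost l m hl hm
    | kp2_range_path l hl => simpa [hψ] using h.kp2_range_path l hl
    | kp2_path_source l hl => simpa [hψ] using h.kp2_path_source l hl
    | kp2_source_ghost l hl => simpa [hψ] using h.kp2_source_ghost l hl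
    | kp2_ghost_range l hl => simpa [hψ] using h.kp2_ghost_range l hl
    | kp3 l m hl hlm => rw [apply_ite ψ]; simpa [hψ] using h.kp3 l m hl hlm
    | kp4 v n hn => simpa [hψ] using h.kp4 v n hn
    | smul r _ ih => rw [map_smul, map_smul, ih]
  have hcon : ∀ a b, kpCon R G a b → ψ a = ψ b := by
    intro a b hab
    change RingConGen.Rel (Rel R G) a b at hab
    induction hab with
    | of x y h => exact hrel _ _ h
    | refl x => rfl
    | symm _ ih => exact ih.symm
    | trans _ _ ih₁ ih₂ => exact ih₁.trans ih₂
    | add _ _ ih₁ ih₂ => rw [map_add, map_add, ih₁, ih₂]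
    | mul _ _ ih₁ ih₂ => rw [map_mul, map_mul, ih₁, ih₂]
  let φ₀ : KumjianPask R G → A := Quotient.lift ψ hcon
  have hφ₀ : ∀ a, φ₀ (mk R G a) = ψ a := fun _ => rfl
  let φ : KumjianPask R G →ₙₐ[R] A :=
    { toFun := φ₀
      map_smul' := fun r x => by
        obtain ⟨a, rfl⟩ := mk_surjective R G x
        rw [← mk_smul, hφ₀, hφ₀, map_smul]; rfl
      map_zero' := by rw [← mk_zero, hφ₀, map_zero]
      map_add' := fun x y => by
        obtain ⟨a, rfl⟩ := mk_surjective R G x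
        obtain ⟨b, rfl⟩ := mk_surjective R G y
        rw [← mk_add, hφ₀, hφ₀, hφ₀, map_add]
      map_mul' := fun x y => by
        obtain ⟨a, rfl⟩ := mk_surjective R G x
        obtain ⟨b, rfl⟩ := mk_surjective R G y
        rw [← mk_mul, hφ₀, hφ₀, hφ₀, map_mul] }
  refine ⟨φ, ⟨fun v => hψ _, fun f => hψ _, fun f => hψ _⟩, ?_⟩
  rintro χ ⟨hP, hS, hT⟩
  have hχ : χ.comp (mkHom R G) = ψ := by
    apply MonoidAlgebra.nonUnitalAlgHom_ext'
    apply FreeSemigroup.hom_ext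
    funext x
    have hx : χ (mk R G (gen R x)) = g x := by
      cases x with
      | vertex v => exact hP v
      | path f => exact hS f
      | ghost f => exact hT f
    exact hx.trans (hψ x).symm
  ext x
  obtain ⟨a, rfl⟩ := mk_surjective R G x
  exact DFunLike.congr_fun hχ a

/-- A pair of paths `(α, β)` with common source is a cycline pair if
`s_{αγ} s_{(αγ)*} = s_{βγ} s_{(βγ)*}` in `KP_R(Λ)` for all paths `γ` with `r(γ) = s(α)`. -/
def IsCyclinePair {x y z : Λ} (α : x ⟶ y) (β : x ⟶ z) : Prop :=
  ∀ ⦃t : Λ⦄ (γ : t ⟶ x),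
    (s G (Path.of (γ ≫ α)) * sGhost G (Path.of (γ ≫ α)) : KumjianPask R G) =
      s G (Path.of (γ ≫ β)) * sGhost G (Path.of (γ ≫ β))

/-- The cycline subalgebra `𝓜`: the (not necessarily unital) `R`-subalgebra of `KP_R(Λ)` generated
by the elements `s_α s_{β*}` with `(α, β)` a cycline pair. -/
noncomputable def cyclineSubalgebra : NonUnitalSubalgebra R (KumjianPask R G) :=
  NonUnitalAlgebra.adjoin R
    {a | ∃ (x y z : Λ) (α : x ⟶ y) (β : x ⟶ z), IsCyclinePair R G α β ∧
      a = s G (Path.of α) * sGhost G (Path.of β)}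

end KumjianPask

end KGraph

/-! Let `KP_R(Λ)` act on the free module with basis the pairs (infinite path, degree in `ℤ^k`):
`s_l` prepends `l` and adds `d(l)`, `s_{l*}` removes the initial segment `l` and subtracts `d(l)`.
Each `s_l s_{l*}` acts diagonally, as the projection onto the infinite paths that begin with `l`.

Every element is a combination of terms `s_a s_{b*}` with all `d(b)` equal to a single `n`
(`exists_mem_spanGhostDegree`). For such a combination, let `(α, β)` occur with coefficient `c ≠ 0`
and let `w` be an infinite path from the common source. The matrix entry from `(βw, 0)` to `(αw,
d(α) - d(β))` is exactly `c`: the degree `n` forces `b = β`, and the second coordinate then forces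
`d(a) = d(α)`, hence `a = α` (`infPathRep_path_mul_ghost_coeff`). An operator that commutes with all
the diagonal projections can have a nonzero entry only between equal infinite paths, so `αw = βw`
for every `w`. This makes `(α, β)` a cycline pair (`isCyclinePair_of_conc_eq`).

Thus every nonzero term already lies in the cycline subalgebra. Faithfulness of the representation
is not needed, and only commutation with the elements `s_l s_{l*}` is used. -/

namespace KGraph

/-! ### Composition, factorization and initial segments of paths -/

variable {k : ℕ} {Λ : Type u} [Category.{v} Λ]

/-- The composite `pq` of two paths with `s(p) = r(q)`. -/
def Path.comp (p q : Path Λ) (h : q.range = p.source) : Path Λ :=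
  ⟨q.source, p.range, q.hom ≫ eqToHom h ≫ p.hom⟩

theorem Path.comp_of {x y z : Λ} (l : y ⟶ z) (m : x ⟶ y) :
    (Path.of l).comp (Path.of m) rfl = Path.of (m ≫ l) := by
  simp [Path.comp]

theorem Path.comp_assoc (a b c : Path Λ) (h : b.range = a.source) (h' : c.range = b.source) :
    (a.comp b h).comp c h' = a.comp (b.comp c h') h := by
  simp [Path.comp]

theorem Path.id_comp (p : Path Λ) (x : Λ) (h : p.range = x) :
    (Path.of (𝟙 x)).comp p h = p := by
  obtain ⟨a, b, f⟩ := p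
  cases h
  simp [Path.comp]

theorem Path.comp_id (p : Path Λ) (x : Λ) (h : x = p.source) :
    p.comp (Path.of (𝟙 x)) h = p := by
  obtain ⟨a, b, f⟩ := p
  cases h
  simp [Path.comp]

theorem Path.comp_congr {a a' b b' : Path Λ} (ha : a = a') (hb : b = b')
    (h : b.range = a.source) : a.comp b h = a'.comp b' (by rw [← ha, ← hb, h]) := by
  subst ha hb
  rfl

variable (G : KGraph k Λ)

theorem d_path_comp (a b : Path Λ) (h : b.range = a.source) :
    G.d (a.comp b h).hom = G.d a.hom + G.d b.hom := by
  obtain ⟨_, _, f⟩ := a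
  obtain ⟨_, _, g⟩ := b
  cases h
  simp [Path.comp, G.d_comp, add_comm]

theorem exists_comp (p : Path Λ) (m n : Fin k → ℕ) (hp : G.d p.hom = m + n) :
    ∃ (a b : Path Λ) (h : b.range = a.source),
      G.d a.hom = m ∧ G.d b.hom = n ∧ p = a.comp b h := by
  obtain ⟨x, z, f⟩ := p
  obtain ⟨⟨y, a, b⟩, ⟨ha, hb, hf⟩, -⟩ := G.unique_factorization f m n hp
  refine ⟨Path.of a, Path.of b, rfl, ha, hb, ?_⟩
  rw [Path.comp_of]
  dsimp only at hf
  rw [hf]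

/-- Degrees are cancellative, so the right factors have equal degrees too, and unique factorization
applies. -/
theorem comp_inj {a b a' b' : Path Λ} {h : b.range = a.source} {h' : b'.range = a'.source}
    (e : a.comp b h = a'.comp b' h') (hd : G.d a.hom = G.d a'.hom) : a = a' ∧ b = b' := by
  have hd' : G.d b.hom = G.d b'.hom := by
    have := congrArg (fun p : Path Λ => G.d p.hom) e
    simp only [d_path_comp, hd] at this
    exact add_left_cancel this
  obtain ⟨_, _, f⟩ := a
  obtain ⟨_, _, g⟩ := b
  obtain ⟨_, _, f'⟩ := a'
  obtain ⟨_, _, g'⟩ := b'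
  cases h
  cases h'
  simp only [Path.comp, eqToHom_refl, Category.id_comp, Path.mk.injEq] at e
  obtain ⟨rfl, rfl, e⟩ := e
  have e := eq_of_heq e
  obtain ⟨p, -, hp⟩ := G.unique_factorization (g ≫ f) _ _
    ((G.d_comp g f).trans (add_comm _ _))
  have h1 := hp ⟨_, f, g⟩ ⟨rfl, rfl, rfl⟩
  have h2 := hp ⟨_, f', g'⟩ ⟨hd.symm, hd'.symm, e.symm⟩
  have h3 := h1.trans h2.symm
  cases h3
  exact ⟨rfl, rfl⟩

/-- The composites of `p` with the identities at its range and at its source are two factorizations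
of `p` whose left factors both have degree zero. -/
theorem eq_id_of_d_eq_zero (p : Path Λ) (hp : G.d p.hom = 0) : p = Path.of (𝟙 p.range) := by
  have e : (Path.of (𝟙 p.range)).comp p rfl = p.comp (Path.of (𝟙 p.source)) rfl := by
    rw [Path.id_comp, Path.comp_id]
  exact (G.comp_inj e (by rw [hp]; exact G.d_id _)).1.symm

/-- The path `p` is an initial segment of the path `q`. -/
def IsPrefix (p q : Path Λ) : Prop := ∃ (g : Path Λ) (h : g.range = p.source), q = p.comp g h

theorem IsPrefix.refl (p : Path Λ) : IsPrefix p p :=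
  ⟨Path.of (𝟙 p.source), rfl, (Path.comp_id _ _ _).symm⟩

theorem IsPrefix.trans {p q r : Path Λ} (h₁ : IsPrefix p q) (h₂ : IsPrefix q r) :
    IsPrefix p r := by
  obtain ⟨g, hg, rfl⟩ := h₁
  obtain ⟨g', hg', rfl⟩ := h₂
  exact ⟨g.comp g' hg', hg, Path.comp_assoc _ _ _ _ _⟩

theorem IsPrefix.comp (p g : Path Λ) (h : g.range = p.source) : IsPrefix p (p.comp g h) :=
  ⟨g, h, rfl⟩

theorem IsPrefix.comp_left {q r : Path Λ} (p : Path Λ) (h : q.range = p.source)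
    (hqr : IsPrefix q r) (h' : r.range = p.source) : IsPrefix (p.comp q h) (p.comp r h') := by
  obtain ⟨g, hg, rfl⟩ := hqr
  exact ⟨g, hg, (Path.comp_assoc _ _ _ _ _).symm⟩

theorem IsPrefix.range_eq {p q : Path Λ} (h : IsPrefix p q) : p.range = q.range := by
  obtain ⟨g, hg, rfl⟩ := h
  rfl

theorem isPrefix_of_comp_left (G : KGraph k Λ) {p q r : Path Λ} {h : q.range = p.source} {h' : r.range = p.source}
    (H : IsPrefix (p.comp q h) (p.comp r h')) : IsPrefix q r := by
  obtain ⟨g, hg, e⟩ := H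
  have e := e.trans (Path.comp_assoc p q g h hg)
  exact ⟨g, hg, (G.comp_inj e rfl).2⟩

variable {G}

theorem IsPrefix.eq {p p' q : Path Λ} (h : IsPrefix p q) (h' : IsPrefix p' q)
    (hd : G.d p.hom = G.d p'.hom) : p = p' := by
  obtain ⟨g, hg, rfl⟩ := h
  obtain ⟨g', hg', e⟩ := h'
  exact (G.comp_inj e hd).1

variable (G)

theorem exists_isPrefix (q : Path Λ) {m : Fin k → ℕ} (hm : m ≤ G.d q.hom) :
    ∃ p, G.d p.hom = m ∧ IsPrefix p q := by
  obtain ⟨a, b, h, ha, -, e⟩ := G.exists_comp q m (G.d q.hom - m)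
    (by rw [add_tsub_cancel_of_le hm])
  exact ⟨a, ha, b, h, e⟩

variable {G}

theorem IsPrefix.isPrefix_of_le {p q r : Path Λ} (hp : IsPrefix p r) (hq : IsPrefix q r)
    (hd : G.d p.hom ≤ G.d q.hom) : IsPrefix p q := by
  obtain ⟨p', hp', h⟩ := G.exists_isPrefix q hd
  rwa [hp.eq (h.trans hq) hp'.symm]

/-! ### Infinite paths: prepending and removing initial segments -/

variable (G)

/-- The infinite paths of a `k`-graph, given by their initial segments. -/
@[ext]
structure InfPath where
  seg : (Fin k → ℕ) → Path Λ
  d_seg : ∀ n, G.d (seg n).hom = n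
  isPrefix_seg : ∀ ⦃m n⦄, m ≤ n → IsPrefix (seg m) (seg n)

namespace InfPath

variable {G}

/-- The range of an infinite path. -/
def range (x : G.InfPath) : Λ := (x.seg 0).range

theorem range_seg (x : G.InfPath) (n : Fin k → ℕ) : (x.seg n).range = x.range :=
  (x.isPrefix_seg (zero_le : 0 ≤ n)).range_eq.symm

theorem seg_eq {x : G.InfPath} {p : Path Λ} {n : Fin k → ℕ} (h : IsPrefix p (x.seg n)) :
    x.seg (G.d p.hom) = p := by
  refine (x.isPrefix_seg ?_).eq h (x.d_seg _)
  obtain ⟨g, hg, e⟩ := h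
  rw [← x.d_seg n, e, d_path_comp]
  exact le_self_add

/-- The degrees above `m` are cofinal. This suits `conc l y`, whose segments are explicit only in
degrees above `d(l)`. -/
theorem ext_of_add {x y : G.InfPath} (m : Fin k → ℕ) (h : ∀ n, x.seg (m + n) = y.seg (m + n)) :
    x = y := by
  apply InfPath.ext
  funext n
  refine (x.isPrefix_seg (le_add_self : n ≤ m + n)).eq (G := G) ?_
    ((x.d_seg n).trans (y.d_seg n).symm)
  rw [h]
  exact y.isPrefix_seg le_add_self

/-- The infinite path with initial segments among those of an increasing family of paths. -/
noncomputable def ofMono (f : (Fin k → ℕ) → Path Λ) (hf : ∀ n, n ≤ G.d (f n).hom)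
    (hm : ∀ ⦃m n⦄, m ≤ n → IsPrefix (f m) (f n)) : G.InfPath where
  seg n := (G.exists_isPrefix (f n) (hf n)).choose
  d_seg n := (G.exists_isPrefix (f n) (hf n)).choose_spec.1
  isPrefix_seg m n hmn := by
    have hm' := (G.exists_isPrefix (f m) (hf m)).choose_spec
    have hn' := (G.exists_isPrefix (f n) (hf n)).choose_spec
    exact (hm'.2.trans (hm hmn)).isPrefix_of_le hn'.2 (by rw [hm'.1, hn'.1]; exact hmn)

theorem ofMono_isPrefix (f : (Fin k → ℕ) → Path Λ) (hf : ∀ n, n ≤ G.d (f n).hom)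
    (hm : ∀ ⦃m n⦄, m ≤ n → IsPrefix (f m) (f n)) (n : Fin k → ℕ) :
    IsPrefix ((ofMono f hf hm).seg n) (f n) :=
  (G.exists_isPrefix (f n) (hf n)).choose_spec.2

/-- The infinite path `ly`. -/
noncomputable def conc (l : Path Λ) (y : G.InfPath) (h : y.range = l.source) : G.InfPath :=
  ofMono (fun n => l.comp (y.seg n) ((y.range_seg n).trans h))
    (fun n => by rw [d_path_comp, y.d_seg]; exact le_add_self)
    (fun _ _ hmn => (y.isPrefix_seg hmn).comp_left _ _ _)

theorem conc_seg (l : Path Λ) (y : G.InfPath) (h : y.range = l.source) (n : Fin k → ℕ) :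
    (conc l y h).seg (G.d l.hom + n) = l.comp (y.seg n) ((y.range_seg n).trans h) := by
  refine (ofMono_isPrefix _ _ _ _).eq (G := G)
    ((y.isPrefix_seg (le_add_self : n ≤ G.d l.hom + n)).comp_left _ _ _) ?_
  rw [d_path_comp, y.d_seg]
  exact d_seg _ _

theorem seg_conc (l : Path Λ) (y : G.InfPath) (h : y.range = l.source) :
    (conc l y h).seg (G.d l.hom) = l :=
  seg_eq (n := G.d l.hom + 0) (by rw [conc_seg]; exact .comp _ _ _)

theorem range_conc (l : Path Λ) (y : G.InfPath) (h : y.range = l.source) :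
    (conc l y h).range = l.range := by
  rw [← range_seg _ (G.d l.hom), seg_conc]

theorem conc_conc (l m : Path Λ) (y : G.InfPath) (h : y.range = m.source)
    (h' : m.range = l.source) :
    conc l (conc m y h) ((range_conc m y h).trans h') = conc (l.comp m h') y h := by
  apply ext_of_add (G.d l.hom + G.d m.hom)
  intro n
  have e := conc_seg (l.comp m h') y h n
  rw [d_path_comp] at e
  rw [e, add_assoc, conc_seg]
  exact (Path.comp_congr rfl (conc_seg _ _ _ _) _).trans
    (Path.comp_assoc l m (y.seg n) h' _).symm

theorem conc_id (y : G.InfPath) (v : Λ) (h : y.range = v) : conc (Path.of (𝟙 v)) y h = y := by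
  apply ext_of_add 0
  intro n
  have e := conc_seg (Path.of (𝟙 v)) y h n
  rw [Path.id_comp, G.d_id] at e
  rw [e, zero_add]

/-- The segments of the tail are the right factors `g m` in `x.seg (n + m) = (x.seg n)(g m)`; left
cancellation makes them coherent. -/
theorem exists_tail (n : Fin k → ℕ) (x : G.InfPath) :
    ∃ (y : G.InfPath) (h : y.range = (x.seg n).source), conc (x.seg n) y h = x := by
  choose g hg e using fun m => x.isPrefix_seg (le_self_add : n ≤ n + m)
  have hd : ∀ m, G.d (g m).hom = m := fun m => by
    have := x.d_seg (n + m)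
    rw [e, d_path_comp, x.d_seg] at this
    exact add_left_cancel this
  refine ⟨⟨g, hd, fun m m' hm => ?_⟩, hg 0, ?_⟩
  · have := x.isPrefix_seg (add_le_add_right hm n)
    rw [e, e m'] at this
    exact G.isPrefix_of_comp_left this
  · apply ext_of_add n
    intro m
    have := conc_seg (x.seg n) ⟨g, hd, fun m m' hm => by
      have := x.isPrefix_seg (add_le_add_right hm n)
      rw [e, e m'] at this
      exact G.isPrefix_of_comp_left this⟩ (hg 0) m
    rw [x.d_seg] at this
    rw [this, e m]

/-- The infinite path obtained by removing the initial segment of degree `n`. -/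
noncomputable def tail (n : Fin k → ℕ) (x : G.InfPath) : G.InfPath := (exists_tail n x).choose

theorem range_tail (n : Fin k → ℕ) (x : G.InfPath) : (tail n x).range = (x.seg n).source :=
  (exists_tail n x).choose_spec.choose

theorem conc_tail (n : Fin k → ℕ) (x : G.InfPath) :
    conc (x.seg n) (tail n x) (range_tail n x) = x :=
  (exists_tail n x).choose_spec.choose_spec

theorem conc_congr {l l' : Path Λ} {y y' : G.InfPath} (hl : l = l') (hy : y = y')
    (h : y.range = l.source) : conc l y h = conc l' y' (by rw [← hl, ← hy, h]) := by
  subst hl hy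
  rfl

theorem conc_inj {l l' : Path Λ} {y y' : G.InfPath} {h : y.range = l.source}
    {h' : y'.range = l'.source} (e : conc l y h = conc l' y' h')
    (hd : G.d l.hom = G.d l'.hom) : l = l' ∧ y = y' := by
  have hl : l = l' := by rw [← seg_conc l y h, ← seg_conc l' y' h', e, hd]
  subst hl
  refine ⟨rfl, InfPath.ext (funext fun n => ?_)⟩
  have := conc_seg l y h n
  rw [e, conc_seg] at this
  exact ((G.comp_inj this rfl).2).symm

theorem tail_conc (l : Path Λ) (y : G.InfPath) (h : y.range = l.source) :
    tail (G.d l.hom) (conc l y h) = y :=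
  (conc_inj (conc_tail (G.d l.hom) (conc l y h)) (by rw [seg_conc])).2

/-- With no sources, paths of degree `(1, …, 1)` can be appended forever. -/
theorem exists_range_eq [G.NoSources] (v : Λ) : ∃ x : G.InfPath, x.range = v := by
  choose f hf using fun w : Λ => NoSources.nonempty_pathsTo (G := G) w 1
  let c : ℕ → Path Λ := fun j => Nat.rec (Path.of (𝟙 v))
    (fun _ p => p.comp (f p.source) (hf p.source).1) j
  have hc : ∀ j, c (j + 1) = (c j).comp (f (c j).source) (hf (c j).source).1 := fun _ => rfl
  have hd : ∀ j : ℕ, G.d (c j).hom = fun _ => j := by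
    intro j
    induction j with
    | zero => exact G.d_id v
    | succ j ih =>
      rw [hc, d_path_comp, ih, (hf _).2]
      rfl
  have hm : ∀ i j, i ≤ j → IsPrefix (c i) (c j) := by
    intro i j hij
    induction j, hij using Nat.le_induction with
    | base => exact .refl _
    | succ j _ ih => exact ih.trans (.comp _ _ _)
  -- The sum of the coordinates of `n` bounds each of them and is monotone in `n`, so `c` at that
  -- index has degree at least `n`.
  refine ⟨ofMono (fun n => c (∑ i, n i)) (fun n i => ?_) (fun m n hmn => hm _ _ ?_), ?_⟩
  · rw [hd]
    exact Finset.single_le_sum (f := n) (fun _ _ => Nat.zero_le _) (Finset.mem_univ i)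
  · exact Finset.sum_le_sum fun i _ => hmn i
  · refine (ofMono_isPrefix _ _ _ 0).range_eq.trans ?_
    simp [c]

end InfPath

end KGraph

/-! ### The representation on infinite paths with a degree -/

namespace KGraph

variable {k : ℕ} {Λ : Type u} [Category.{v} Λ]

variable (R : Type w) [CommRing R] (G : KGraph k Λ)

namespace InfPath

variable {G}

theorem seg_add (x : G.InfPath) (m n : Fin k → ℕ) :
    x.seg (m + n) = (x.seg m).comp ((tail m x).seg n)
      ((range_seg _ _).trans (range_tail m x)) := by
  have h := conc_seg (x.seg m) (tail m x) (range_tail m x) n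
  rwa [conc_tail, x.d_seg] at h

theorem tail_add (x : G.InfPath) (m n : Fin k → ℕ) : tail (m + n) x = tail n (tail m x) := by
  have h : (tail n (tail m x)).range = (x.seg (m + n)).source := by
    rw [range_tail, seg_add]
    rfl
  have e : conc (x.seg (m + n)) (tail n (tail m x)) h = x := by
    refine (conc_congr (seg_add x m n) rfl _).trans ?_
    refine (conc_conc (x.seg m) ((tail m x).seg n) (tail n (tail m x)) (range_tail _ _)
      ((range_seg _ _).trans (range_tail m x))).symm.trans ?_
    exact (conc_congr rfl (conc_tail n (tail m x)) _).trans (conc_tail m x)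
  exact (conc_inj ((conc_tail (m + n) x).trans e.symm) rfl).2

theorem seg_zero (x : G.InfPath) : x.seg 0 = Path.of (𝟙 x.range) :=
  G.eq_id_of_d_eq_zero _ (x.d_seg 0)

theorem tail_zero (x : G.InfPath) : tail 0 x = x := by
  have h := conc_tail 0 x
  have h' : (tail 0 x).range = x.range := by rw [range_tail, seg_zero]
  rw [conc_congr (seg_zero x) rfl, conc_id _ _ h'] at h
  exact h

end InfPath

open InfPath

/-- The free module on pairs of an infinite path and a degree in `ℤ^k`. -/
abbrev InfPathModule := (G.InfPath × (Fin k → ℤ)) →₀ R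

/-- The degree of a path in `ℤ^k`. -/
def intDegree (p : Path Λ) : Fin k → ℤ := fun i => (G.d p.hom i : ℤ)

theorem intDegree_comp (a b : Path Λ) (h : b.range = a.source) :
    G.intDegree (a.comp b h) = G.intDegree a + G.intDegree b := by
  funext i
  simp [intDegree, d_path_comp]

theorem intDegree_eq_iff (a b : Path Λ) :
    G.intDegree a = G.intDegree b ↔ G.d a.hom = G.d b.hom := by
  simp [intDegree, funext_iff]

theorem intDegree_id (v : Λ) : G.intDegree (Path.of (𝟙 v)) = 0 := by
  funext i
  simp [intDegree, G.d_id]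

open Classical in
/-- The projection onto the infinite paths of range `v`. -/
noncomputable def vertexOp (v : Λ) : Module.End R (InfPathModule R G) :=
  Finsupp.linearCombination R fun b => if b.1.range = v then Finsupp.single b 1 else 0

open Classical in
/-- The operator that prepends the path `l` to infinite paths. -/
noncomputable def pathOp (l : Path Λ) : Module.End R (InfPathModule R G) :=
  Finsupp.linearCombination R fun b =>
    if h : b.1.range = l.source then Finsupp.single (conc l b.1 h, b.2 + G.intDegree l) 1 else 0

open Classical in
/-- The operator that removes the initial segment `l` from infinite paths. -/
noncomputable def ghostOp (l : Path Λ) : Module.End R (InfPathModule R G) :=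
  Finsupp.linearCombination R fun b =>
    if b.1.seg (G.d l.hom) = l then
      Finsupp.single (tail (G.d l.hom) b.1, b.2 - G.intDegree l) 1 else 0

open Classical in
theorem vertexOp_single (v : Λ) (x : G.InfPath) (j : Fin k → ℤ) :
    vertexOp R G v (Finsupp.single (x, j) 1) =
      if x.range = v then Finsupp.single (x, j) 1 else 0 := by
  simp [vertexOp]

open Classical in
theorem pathOp_single (l : Path Λ) (x : G.InfPath) (j : Fin k → ℤ) :
    pathOp R G l (Finsupp.single (x, j) 1) =
      if h : x.range = l.source then Finsupp.single (conc l x h, j + G.intDegree l) 1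
      else 0 := by
  simp [pathOp]

open Classical in
theorem ghostOp_single (l : Path Λ) (x : G.InfPath) (j : Fin k → ℤ) :
    ghostOp R G l (Finsupp.single (x, j) 1) =
      if x.seg (G.d l.hom) = l then
        Finsupp.single (tail (G.d l.hom) x, j - G.intDegree l) 1 else 0 := by
  simp [ghostOp]

open Classical in
theorem pathOp_mul_ghostOp_single (l : Path Λ) (x : G.InfPath) (j : Fin k → ℤ) :
    (pathOp R G l * ghostOp R G l) (Finsupp.single (x, j) 1) =
      if x.seg (G.d l.hom) = l then Finsupp.single (x, j) 1 else 0 := by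
  rw [Module.End.mul_apply, ghostOp_single]
  split_ifs with h
  · have h' : (tail (G.d l.hom) x).range = l.source := by rw [range_tail, h]
    rw [pathOp_single, dif_pos h', sub_add_cancel]
    congr 2
    exact (conc_congr h.symm rfl _).trans (conc_tail _ x)
  · rw [map_zero]

variable {R G} in
theorem infPathModule_end_ext {f g : Module.End R (InfPathModule R G)}
    (h : ∀ x j, f (Finsupp.single (x, j) 1) = g (Finsupp.single (x, j) 1)) : f = g :=
  Finsupp.lhom_ext' fun b => LinearMap.ext_ring (h b.1 b.2)

/-- All relations are checked on basis vectors. The last one holds because an infinite path has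
exactly one initial segment of each degree. -/
theorem isKumjianPaskFamily_infPathModule [G.RowFinite] :
    G.IsKumjianPaskFamily (vertexOp R G) (pathOp R G) (ghostOp R G) where
  path_vertex v := infPathModule_end_ext fun x j => by
    rw [pathOp_single, vertexOp_single]
    split_ifs with h
    · rw [conc_id, intDegree_id, add_zero]
    · rfl
  ghost_vertex v := infPathModule_end_ext fun x j => by
    have h : x.seg (G.d (Path.of (𝟙 v)).hom) = Path.of (𝟙 v) ↔ x.range = v := by
      rw [G.d_id, seg_zero]
      refine ⟨fun h => congrArg Path.range h, ?_⟩
      rintro rfl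
      rfl
    rw [ghostOp_single, vertexOp_single, G.d_id, tail_zero, intDegree_id, sub_zero]
    rw [G.d_id] at h
    classical
    exact if_congr h rfl rfl
  kp1 v w := infPathModule_end_ext fun x j => by
    rw [Module.End.mul_apply, vertexOp_single]
    by_cases hw : x.range = w
    · rw [if_pos hw, vertexOp_single]
      by_cases hv : v = w
      · rw [if_pos hv, vertexOp_single]
      · rw [if_neg hv, if_neg (fun h => hv (h.symm.trans hw))]
        rfl
    · rw [if_neg hw, map_zero]
      by_cases hv : v = w
      · rw [if_pos hv, vertexOp_single, if_neg (fun h => hw (h.trans hv))]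
      · rw [if_neg hv]
        rfl
  kp2_path l m _ _ := infPathModule_end_ext fun x j => by
    rw [Module.End.mul_apply, ← Path.comp_of, pathOp_single, pathOp_single]
    by_cases h : x.range = (Path.of m).source
    · have h' : x.range = ((Path.of l).comp (Path.of m) rfl).source := h
      rw [dif_pos h, dif_pos h', pathOp_single, dif_pos (range_conc _ _ _), intDegree_comp,
        add_assoc, add_comm (G.intDegree _), conc_conc _ _ _ h rfl]
    · have h' : ¬ x.range = ((Path.of l).comp (Path.of m) rfl).source := h
      rw [dif_neg h, dif_neg h', map_zero]
  kp2_ghost l m _ _ := infPathModule_end_ext fun x j => by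
    rw [Module.End.mul_apply, ← Path.comp_of, ghostOp_single, ghostOp_single, d_path_comp,
      tail_add, intDegree_comp]
    by_cases h : x.seg (G.d (Path.of l).hom) = Path.of l
    · rw [if_pos h, ghostOp_single, sub_sub]
      classical
      refine if_congr ⟨fun h' => ?_, fun h' => ?_⟩ rfl rfl
      · exact (seg_add _ _ _).trans (Path.comp_congr h h' _)
      · exact (G.comp_inj ((seg_add _ _ _).symm.trans h') (x.d_seg _)).2
    · rw [if_neg h, map_zero, if_neg]
      exact fun h' => h (G.comp_inj ((seg_add _ _ _).symm.trans h') (x.d_seg _)).1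
  kp2_range_path l _ := infPathModule_end_ext fun x j => by
    rw [Module.End.mul_apply, pathOp_single]
    split_ifs with h
    · rw [vertexOp_single, if_pos (range_conc _ _ _)]
    · rw [map_zero]
  kp2_path_source l _ := infPathModule_end_ext fun x j => by
    rw [Module.End.mul_apply, vertexOp_single, pathOp_single]
    split_ifs with h
    · rw [pathOp_single, dif_pos h]
    · rw [map_zero]
  kp2_source_ghost l _ := infPathModule_end_ext fun x j => by
    rw [Module.End.mul_apply, ghostOp_single]
    split_ifs with h
    · rw [vertexOp_single, if_pos (by rw [range_tail, h])]
    · rw [map_zero]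
  kp2_ghost_range l _ := infPathModule_end_ext fun x j => by
    rw [Module.End.mul_apply, vertexOp_single, ghostOp_single]
    by_cases h : x.range = l.range
    · rw [if_pos h, ghostOp_single]
    · rw [if_neg h, map_zero, if_neg]
      exact fun h' => h (by rw [← x.range_seg (G.d l.hom), h'])
  kp3 l m _ hlm := infPathModule_end_ext fun x j => by
    rw [Module.End.mul_apply, pathOp_single]
    by_cases h : x.range = m.source
    · rw [dif_pos h, ghostOp_single, hlm, seg_conc, tail_conc]
      by_cases hl : l = m
      · subst hl
        rw [if_pos rfl, if_pos rfl, vertexOp_single, if_pos h, add_sub_cancel_right]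
      · rw [if_neg (Ne.symm hl), if_neg hl]
        rfl
    · rw [dif_neg h, map_zero]
      by_cases hl : l = m
      · subst hl
        rw [if_pos rfl, vertexOp_single, if_neg h]
      · rw [if_neg hl]
        rfl
  kp4 v n _ := infPathModule_end_ext fun x j => by
    classical
    have h : ∀ l ∈ G.pathsToFinset v n, (pathOp R G l * ghostOp R G l) (Finsupp.single (x, j) 1) =
        if x.seg n = l then Finsupp.single (x, j) 1 else 0 := by
      intro l hl
      have hl : l.range = v ∧ G.d l.hom = n := by simpa [pathsToFinset, pathsTo] using hl
      rw [pathOp_mul_ghostOp_single, hl.2]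
    rw [LinearMap.sum_apply, Finset.sum_congr rfl h, Finset.sum_ite_eq, vertexOp_single]
    simp [pathsToFinset, pathsTo, range_seg, d_seg]

end KGraph

/-! ### Identities in a Kumjian-Pask family, including degree zero -/

namespace KGraph

variable {k : ℕ} {Λ : Type u} [Category.{v} Λ]

theorem mem_pathsToFinset {G : KGraph k Λ} [G.RowFinite] {v : Λ} {n : Fin k → ℕ} {l : Path Λ} :
    l ∈ G.pathsToFinset v n ↔ l.range = v ∧ G.d l.hom = n := by
  simp [pathsToFinset, pathsTo]

namespace IsKumjianPaskFamily

variable {G : KGraph k Λ} [G.RowFinite] {A : Type*} [NonUnitalRing A]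
  {P : Λ → A} {S T : Path Λ → A} (H : G.IsKumjianPaskFamily P S T)

include H

theorem vertex_mul_self (v : Λ) : P v * P v = P v := by
  rw [H.kp1, if_pos rfl]

theorem vertex_mul_of_ne {v w : Λ} (h : v ≠ w) : P v * P w = 0 := by
  rw [H.kp1, if_neg h]

/-- The defining relations speak of nonzero degrees only. In degree zero a path is an identity, so
this and the next identities reduce to those of the vertex idempotents. -/
theorem range_mul_path (l : Path Λ) : P l.range * S l = S l := by
  by_cases h : G.d l.hom = 0
  · rw [G.eq_id_of_d_eq_zero l h, H.path_vertex, H.vertex_mul_self]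
  · exact H.kp2_range_path l h

theorem path_mul_source (l : Path Λ) : S l * P l.source = S l := by
  by_cases h : G.d l.hom = 0
  · rw [G.eq_id_of_d_eq_zero l h, H.path_vertex, H.vertex_mul_self]
  · exact H.kp2_path_source l h

theorem source_mul_ghost (l : Path Λ) : P l.source * T l = T l := by
  by_cases h : G.d l.hom = 0
  · rw [G.eq_id_of_d_eq_zero l h, H.ghost_vertex, H.vertex_mul_self]
  · exact H.kp2_source_ghost l h

theorem ghost_mul_range (l : Path Λ) : T l * P l.range = T l := by
  by_cases h : G.d l.hom = 0
  · rw [G.eq_id_of_d_eq_zero l h, H.ghost_vertex, H.vertex_mul_self]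
  · exact H.kp2_ghost_range l h

theorem path_mul_path (a b : Path Λ) (h : b.range = a.source) : S a * S b = S (a.comp b h) := by
  by_cases ha : G.d a.hom = 0
  · have ha := G.eq_id_of_d_eq_zero a ha
    generalize a.range = x at ha
    subst ha
    rw [Path.id_comp, H.path_vertex, show x = b.range from h.symm, H.range_mul_path]
  by_cases hb : G.d b.hom = 0
  · have hb := G.eq_id_of_d_eq_zero b hb
    generalize b.range = x at hb
    subst hb
    rw [Path.comp_id, H.path_vertex, show x = a.source from h, H.path_mul_source]
  obtain ⟨_, _, f⟩ := a
  obtain ⟨_, _, g⟩ := b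
  cases h
  exact (H.kp2_path f g ha hb).trans (by rw [← Path.comp_of])

theorem ghost_mul_ghost (a b : Path Λ) (h : b.range = a.source) :
    T b * T a = T (a.comp b h) := by
  by_cases ha : G.d a.hom = 0
  · have ha := G.eq_id_of_d_eq_zero a ha
    generalize a.range = x at ha
    subst ha
    rw [Path.id_comp, H.ghost_vertex, show x = b.range from h.symm, H.ghost_mul_range]
  by_cases hb : G.d b.hom = 0
  · have hb := G.eq_id_of_d_eq_zero b hb
    generalize b.range = x at hb
    subst hb
    rw [Path.comp_id, H.ghost_vertex, show x = a.source from h, H.source_mul_ghost]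
  obtain ⟨_, _, f⟩ := a
  obtain ⟨_, _, g⟩ := b
  cases h
  exact (H.kp2_ghost f g ha hb).trans (by rw [← Path.comp_of])

theorem ghost_mul_ghost_of_ne (a b : Path Λ) (h : b.range ≠ a.source) : T b * T a = 0 := by
  rw [← H.ghost_mul_range b, ← H.source_mul_ghost a, mul_assoc, ← mul_assoc (P _) (P _),
    H.vertex_mul_of_ne h, zero_mul, mul_zero]

theorem path_mul_ghost_of_ne (a b : Path Λ) (h : a.source ≠ b.source) : S a * T b = 0 := by
  rw [← H.path_mul_source a, ← H.source_mul_ghost b, mul_assoc, ← mul_assoc (P _) (P _),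
    H.vertex_mul_of_ne h, zero_mul, mul_zero]

open Classical in
theorem ghost_mul_path (a b : Path Λ) (h : G.d a.hom = G.d b.hom) :
    T a * S b = if a = b then P a.source else 0 := by
  by_cases ha : G.d a.hom = 0
  · have ha := G.eq_id_of_d_eq_zero a ha
    have hb := G.eq_id_of_d_eq_zero b (by rwa [← h])
    generalize a.range = x at ha
    generalize b.range = y at hb
    subst ha hb
    rw [H.ghost_vertex, H.path_vertex, H.kp1]
    refine if_congr ⟨fun h => by rw [h], fun h => congrArg Path.range h⟩ rfl rfl
  · convert H.kp3 a b ha h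

theorem vertex_eq_sum (v : Λ) (n : Fin k → ℕ) :
    P v = ∑ l ∈ G.pathsToFinset v n, S l * T l := by
  by_cases hn : n = 0
  · subst hn
    have : G.pathsToFinset v 0 = {Path.of (𝟙 v)} := by
      ext l
      rw [mem_pathsToFinset, Finset.mem_singleton]
      constructor
      · rintro ⟨rfl, h⟩
        exact G.eq_id_of_d_eq_zero l h
      · rintro rfl
        exact ⟨rfl, G.d_id v⟩
    rw [this, Finset.sum_singleton, H.path_vertex, H.ghost_vertex, H.vertex_mul_self]
  · exact H.kp4 v n hn

open Classical in
theorem ghost_comp_mul_path (a b l : Path Λ) (h : b.range = a.source)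
    (hd : G.d a.hom = G.d l.hom) :
    T (a.comp b h) * S l = if a = l then T b else 0 := by
  rw [← H.ghost_mul_ghost, mul_assoc, H.ghost_mul_path a l hd]
  split_ifs with e
  · rw [← h, H.ghost_mul_range]
  · rw [mul_zero]

open Classical in
-- Expand the range idempotent in degree `n`: a summand `s_a s_{a*}` is killed by `s_l` unless the
-- initial segment of `a` of degree `d(l)` is `l`. Projections of different degrees thus become
-- comparable.
theorem path_mul_ghost_eq_sum (l : Path Λ) {n : Fin k → ℕ} (hn : G.d l.hom ≤ n) :
    S l * T l =
      ∑ a ∈ G.pathsToFinset l.range n, if IsPrefix l a then S a * T a else 0 := by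
  rw [← H.range_mul_path, H.vertex_eq_sum l.range n, Finset.sum_mul, Finset.sum_mul]
  refine Finset.sum_congr rfl fun a ha => ?_
  obtain ⟨b, c, h, hb, -, rfl⟩ := G.exists_comp a (G.d l.hom) (n - G.d l.hom)
    (by rw [(mem_pathsToFinset.1 ha).2, add_tsub_cancel_of_le hn])
  rw [mul_assoc (S _), H.ghost_comp_mul_path _ _ _ _ hb, mul_assoc]
  by_cases e : b = l
  · subst e
    rw [if_pos rfl, if_pos (.comp _ _ _), H.ghost_mul_ghost]
  · rw [if_neg e, if_neg, zero_mul, mul_zero]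
    exact fun h' => e ((IsPrefix.comp b c h).eq h' hb)

end IsKumjianPaskFamily

/-! ### Spanning by products with ghost part of a fixed degree -/

namespace KumjianPask

variable (R : Type w) [CommRing R] (G : KGraph k Λ) [G.RowFinite]

/-- The span of the elements `s_a s_{b*}` with `d(b) = n`. -/
noncomputable def spanGhostDegree (n : Fin k → ℕ) : Submodule R (KumjianPask R G) :=
  Submodule.span R ((fun ab : Path Λ × Path Λ => s G ab.1 * sGhost G ab.2) ''
    {ab | G.d ab.2.hom = n})

variable {R G}

theorem mul_mem_spanGhostDegree (a b : Path Λ) {n : Fin k → ℕ} (h : G.d b.hom = n) :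
    s G a * sGhost G b ∈ spanGhostDegree R G n :=
  Submodule.subset_span ⟨(a, b), h, rfl⟩

theorem spanGhostDegree_le_comap {n : Fin k → ℕ} {M : Submodule R (KumjianPask R G)}
    (y : KumjianPask R G)
    (h : ∀ a b : Path Λ, a.source = b.source → G.d b.hom = n → s G a * sGhost G b * y ∈ M)
    {x : KumjianPask R G} (hx : x ∈ spanGhostDegree R G n) : x * y ∈ M := by
  induction hx using Submodule.span_induction with
  | mem x hx =>
    obtain ⟨⟨a, b⟩, hd, rfl⟩ := hx
    by_cases e : a.source = b.source
    · exact h a b e hd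
    · dsimp only
      rw [(isKumjianPaskFamily R G).path_mul_ghost_of_ne a b e, zero_mul]
      exact M.zero_mem
  | zero => rw [zero_mul]; exact M.zero_mem
  | add x x' _ _ ih ih' => rw [add_mul]; exact M.add_mem ih ih'
  | smul r x _ ih => rw [smul_mul_assoc]; exact M.smul_mem r ih

/-- Inserting the expansion of the source idempotent in degree `m - n` between `s_a` and `s_{b*}`
lengthens both paths. These spans are therefore directed, and one degree serves all terms of an
element. -/
theorem spanGhostDegree_mono : Monotone (spanGhostDegree R G) := by
  intro n m hnm
  have H := isKumjianPaskFamily R G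
  refine Submodule.span_le.2 ?_
  rintro _ ⟨⟨a, b⟩, hd, rfl⟩
  have hd : G.d b.hom = n := hd
  dsimp only [SetLike.mem_coe]
  by_cases e : a.source = b.source
  · rw [← H.path_mul_source, H.vertex_eq_sum a.source (m - n), Finset.mul_sum, Finset.sum_mul]
    refine Submodule.sum_mem _ fun l hl => ?_
    obtain ⟨hl, hl'⟩ := mem_pathsToFinset.1 hl
    rw [← mul_assoc, mul_assoc, H.path_mul_path a l hl, H.ghost_mul_ghost b l (hl.trans e)]
    exact mul_mem_spanGhostDegree _ _
      (by rw [d_path_comp, hd, hl', add_tsub_cancel_of_le hnm])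
  · rw [H.path_mul_ghost_of_ne a b e]
    exact Submodule.zero_mem _

theorem mem_iSup_spanGhostDegree {x : KumjianPask R G} :
    x ∈ ⨆ n, spanGhostDegree R G n ↔ ∃ n, x ∈ spanGhostDegree R G n :=
  Submodule.mem_iSup_of_directed _ spanGhostDegree_mono.directed_le

theorem mem_iSup_and_mul_mem_gen (g : Gen Λ) :
    mk R G (gen R g) ∈ ⨆ n, spanGhostDegree R G n ∧
      ∀ x ∈ ⨆ n, spanGhostDegree R G n, x * mk R G (gen R g) ∈ ⨆ n, spanGhostDegree R G n := by
  have H := isKumjianPaskFamily R G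
  have mem : ∀ a b : Path Λ, s G a * sGhost G b ∈ ⨆ n, spanGhostDegree R G n := fun a b =>
    mem_iSup_spanGhostDegree.2 ⟨_, mul_mem_spanGhostDegree a b rfl⟩
  cases g with
  | vertex v =>
    change p G v ∈ _ ∧ ∀ x ∈ _, x * p G v ∈ _
    constructor
    · rw [← H.vertex_mul_self]
      nth_rw 1 [← H.path_vertex]
      rw [← H.ghost_vertex]
      exact mem _ _
    · intro x hx
      obtain ⟨n, hx⟩ := mem_iSup_spanGhostDegree.1 hx
      refine spanGhostDegree_le_comap _ (fun a b _ _ => ?_) hx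
      rw [mul_assoc, ← H.ghost_mul_range b, mul_assoc, H.kp1]
      split_ifs with e
      · rw [H.ghost_mul_range]
        exact mem _ _
      · rw [mul_zero, mul_zero]
        exact Submodule.zero_mem _
  | path l =>
    change s G l ∈ _ ∧ ∀ x ∈ _, x * s G l ∈ _
    constructor
    · rw [← H.path_mul_source, ← H.ghost_vertex]
      exact mem _ _
    · intro x hx
      obtain ⟨n, hx⟩ := mem_iSup_spanGhostDegree.1 hx
      -- Raise the ghost degree above `d(l)`, so that an initial segment of `b` of degree `d(l)` can
      -- be paired with `l`.
      have hx := spanGhostDegree_mono (le_add_self : n ≤ G.d l.hom + n) hx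
      refine spanGhostDegree_le_comap _ (fun a b _ hd => ?_) hx
      obtain ⟨b, c, h, hb, -, rfl⟩ := G.exists_comp b _ _ hd
      rw [mul_assoc, H.ghost_comp_mul_path _ _ _ _ hb]
      split_ifs with e
      · exact mem _ _
      · rw [mul_zero]
        exact Submodule.zero_mem _
  | ghost l =>
    change sGhost G l ∈ _ ∧ ∀ x ∈ _, x * sGhost G l ∈ _
    constructor
    · rw [← H.source_mul_ghost, ← H.path_vertex]
      exact mem _ _
    · intro x hx
      obtain ⟨n, hx⟩ := mem_iSup_spanGhostDegree.1 hx
      refine spanGhostDegree_le_comap _ (fun a b _ _ => ?_) hx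
      rw [mul_assoc]
      by_cases e : b.range = l.source
      · rw [H.ghost_mul_ghost l b e]
        exact mem _ _
      · rw [H.ghost_mul_ghost_of_ne l b e, mul_zero]
        exact Submodule.zero_mem _

theorem exists_mem_spanGhostDegree (x : KumjianPask R G) : ∃ n, x ∈ spanGhostDegree R G n := by
  rw [← mem_iSup_spanGhostDegree]
  obtain ⟨a, rfl⟩ := mk_surjective R G x
  -- Stability under right multiplication is carried along, so that words can be treated letter by
  -- letter.
  suffices h : mk R G a ∈ ⨆ n, spanGhostDegree R G n ∧
      ∀ x ∈ ⨆ n, spanGhostDegree R G n, x * mk R G a ∈ ⨆ n, spanGhostDegree R G n from h.1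
  induction a using MonoidAlgebra.induction_linear with
  | zero =>
    rw [mk_zero]
    exact ⟨Submodule.zero_mem _, fun x _ => by rw [mul_zero]; exact Submodule.zero_mem _⟩
  | add a b ha hb =>
    rw [mk_add]
    exact ⟨Submodule.add_mem _ ha.1 hb.1, fun x hx => by
      rw [mul_add]
      exact Submodule.add_mem _ (ha.2 x hx) (hb.2 x hx)⟩
  | single m r =>
    have hr : (MonoidAlgebra.single m r : FreeAlg R Λ) = r • MonoidAlgebra.single m 1 := by
      rw [MonoidAlgebra.smul_single, smul_eq_mul, mul_one]
    suffices h : mk R G (MonoidAlgebra.single m 1) ∈ ⨆ n, spanGhostDegree R G n ∧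
        ∀ x ∈ ⨆ n, spanGhostDegree R G n,
          x * mk R G (MonoidAlgebra.single m 1) ∈ ⨆ n, spanGhostDegree R G n by
      rw [hr, mk_smul]
      exact ⟨Submodule.smul_mem _ _ h.1, fun x hx => by
        rw [mul_smul_comm]
        exact Submodule.smul_mem _ _ (h.2 x hx)⟩
    induction m using FreeSemigroup.recOnMul with
    | ih1 g => exact mem_iSup_and_mul_mem_gen g
    | ih2 g m hg hm =>
      have e : (MonoidAlgebra.single (FreeSemigroup.of g * m) 1 : FreeAlg R Λ) =
          MonoidAlgebra.single (FreeSemigroup.of g) 1 * MonoidAlgebra.single m 1 := by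
        rw [MonoidAlgebra.single_mul_single, one_mul]
      have hg := mem_iSup_and_mul_mem_gen (R := R) (G := G) g
      have hm := hm (by rw [MonoidAlgebra.smul_single, smul_eq_mul, mul_one])
      rw [e, mk_mul]
      exact ⟨hm.2 _ hg.1, fun x hx => by
        rw [← mul_assoc]
        exact hm.2 _ (hg.2 x hx)⟩

end KumjianPask

end KGraph

/-! ### Cycline pairs and elements commuting with the diagonal -/

namespace KGraph

variable {k : ℕ} {Λ : Type u} [Category.{v} Λ]

open InfPath

namespace KumjianPask

variable {R : Type w} [CommRing R] {G : KGraph k Λ} [G.RowFinite]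

/-- Expand both projections in a common degree. A path of that degree extends `αγ` exactly when it
extends `βγ`, since it can be prolonged to an infinite path, where `α` and `β` are interchangeable.
-/
theorem isCyclinePair_of_conc_eq [G.NoSources] {x y z : Λ} (α : x ⟶ y) (β : x ⟶ z)
    (h : ∀ (w : G.InfPath) (hw : w.range = x), conc (Path.of α) w hw = conc (Path.of β) w hw) :
    IsCyclinePair R G α β := by
  classical
  have H := isKumjianPaskFamily R G
  intro t γ
  have hγ : ∀ (w : G.InfPath) (hw : w.range = t),
      conc (Path.of (γ ≫ α)) w hw = conc (Path.of (γ ≫ β)) w hw := by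
    intro w hw
    have e₁ := conc_conc (Path.of α) (Path.of γ) w hw rfl
    have e₂ := conc_conc (Path.of β) (Path.of γ) w hw rfl
    rw [h] at e₁
    exact (conc_congr (Path.comp_of α γ) rfl _).symm.trans
      (e₁.symm.trans (e₂.trans (conc_congr (Path.comp_of β γ) rfl _)))
  -- The two sums must run over the same set of paths, so the ranges have to agree; one infinite
  -- path with range `t` shows it.
  obtain rfl : y = z := by
    obtain ⟨w, hw⟩ := exists_range_eq (G := G) t
    exact (range_conc (Path.of (γ ≫ α)) w hw).symm.trans
      ((congrArg range (hγ w hw)).trans (range_conc _ _ _))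
  have key : ∀ (a b : t ⟶ y) (_ : ∀ (w : G.InfPath) (hw : w.range = t),
      conc (Path.of a) w hw = conc (Path.of b) w hw) (n : Fin k → ℕ) (_ : G.d b ≤ n)
      (l : Path Λ), G.d l.hom = n → IsPrefix (Path.of a) l → IsPrefix (Path.of b) l := by
    rintro a b hab n hn l hl ⟨g, hg, rfl⟩
    obtain ⟨w, hw⟩ := exists_range_eq (G := G) g.source
    have e : conc ((Path.of a).comp g hg) w hw =
        conc (Path.of b) (conc g w hw) ((range_conc _ _ _).trans hg) := by
      rw [← hab]
      exact (conc_conc (Path.of a) g w hw hg).symm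
    have h₁ := seg_conc ((Path.of a).comp g hg) w hw
    have h₂ := seg_conc (Path.of b) (conc g w hw) ((range_conc _ _ _).trans hg)
    have h₃ := isPrefix_seg (conc (Path.of b) (conc g w hw) ((range_conc _ _ _).trans hg)) hn
    rw [h₂, ← e, ← hl, h₁] at h₃
    exact h₃
  have ha : G.d (γ ≫ α) ≤ G.d (γ ≫ α) + G.d (γ ≫ β) := le_self_add
  have hb : G.d (γ ≫ β) ≤ G.d (γ ≫ α) + G.d (γ ≫ β) := le_add_self
  rw [H.path_mul_ghost_eq_sum (Path.of (γ ≫ α)) ha, H.path_mul_ghost_eq_sum (Path.of (γ ≫ β)) hb]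
  refine Finset.sum_congr rfl fun l hl => if_congr ?_ rfl rfl
  have hl := (mem_pathsToFinset.1 hl).2
  exact ⟨key _ _ hγ _ hb l hl, key _ _ (fun w hw => (hγ w hw).symm) _ ha l hl⟩

variable (R G) in
/-- The representation of the Kumjian-Pask algebra on the free module on infinite paths and
degrees. -/
noncomputable def infPathRep : KumjianPask R G →ₙₐ[R] Module.End R (InfPathModule R G) :=
  (existsUnique_lift R G (isKumjianPaskFamily_infPathModule R G)).choose

theorem infPathRep_s (l : Path Λ) : infPathRep R G (s G l) = pathOp R G l :=
  (existsUnique_lift R G (isKumjianPaskFamily_infPathModule R G)).choose_spec.1.2.1 l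

theorem infPathRep_sGhost (l : Path Λ) : infPathRep R G (sGhost G l) = ghostOp R G l :=
  (existsUnique_lift R G (isKumjianPaskFamily_infPathModule R G)).choose_spec.1.2.2 l

open Classical in
theorem infPathRep_path_mul_ghost_apply (l : Path Λ) (f : InfPathModule R G)
    (b : G.InfPath × (Fin k → ℤ)) :
    infPathRep R G (s G l * sGhost G l) f b = if b.1.seg (G.d l.hom) = l then f b else 0 := by
  rw [map_mul, infPathRep_s, infPathRep_sGhost]
  induction f using Finsupp.induction_linear with
  | zero => simp
  | add f g hf hg =>
    rw [map_add, Finsupp.add_apply, hf, hg, Finsupp.add_apply]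
    split_ifs
    · rfl
    · rw [add_zero]
  | single c r =>
    obtain ⟨x, j⟩ := c
    have hr : (Finsupp.single (x, j) r : InfPathModule R G) = r • Finsupp.single (x, j) 1 := by
      rw [Finsupp.smul_single, smul_eq_mul, mul_one]
    rw [hr, map_smul, pathOp_mul_ghostOp_single, Finsupp.smul_apply, Finsupp.smul_apply]
    by_cases hb : (x, j) = b
    · subst hb
      split_ifs <;> simp
    · have h0 : (Finsupp.single (x, j) 1 : InfPathModule R G) b = 0 :=
        Finsupp.single_eq_of_ne (Ne.symm hb)
      rw [apply_ite (fun f : InfPathModule R G => f b), h0]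
      simp

open Classical in
-- The degree coordinate is essential here: `az = αz` alone does not give `a = α`, but it does once
-- `d(a) = d(α)`.
theorem infPathRep_path_mul_ghost_coeff {α β : Path Λ} (a b : Path Λ)
    (hb : G.d b.hom = G.d β.hom) (z : G.InfPath) (hα : z.range = α.source)
    (hβ : z.range = β.source) :
    infPathRep R G (s G a * sGhost G b) (Finsupp.single (conc β z hβ, 0) 1)
      (conc α z hα, -G.intDegree β + G.intDegree α) = if (a, b) = (α, β) then 1 else 0 := by
  rw [map_mul, infPathRep_s, infPathRep_sGhost, Module.End.mul_apply, ghostOp_single, hb,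
    seg_conc, tail_conc, zero_sub]
  by_cases e : b = β
  · subst e
    rw [if_pos rfl, pathOp_single]
    by_cases ha : a = α
    · subst ha
      rw [dif_pos hα, if_pos rfl, Finsupp.single_eq_same]
    · rw [if_neg fun h => ha (congrArg Prod.fst h)]
      split_ifs with h
      · refine Finsupp.single_eq_of_ne fun h' => ha ?_
        rw [Prod.mk.injEq, add_right_inj, intDegree_eq_iff] at h'
        exact (conc_inj h'.1.symm h'.2.symm).1
      · rfl
  · rw [if_neg (Ne.symm e), map_zero, if_neg fun h => e (congrArg Prod.snd h)]
    rfl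

/-- An element that commutes with all the elements `s_l s_{l*}` is in the cycline subalgebra. -/
theorem mem_cyclineSubalgebra_of_commute [G.NoSources] {x : KumjianPask R G}
    (hx : ∀ l : Path Λ, Commute x (s G l * sGhost G l)) : x ∈ cyclineSubalgebra R G := by
  classical
  obtain ⟨n, hn⟩ := exists_mem_spanGhostDegree x
  obtain ⟨c, hc, rfl⟩ := (Finsupp.mem_span_image_iff_linearCombination R).1 hn
  have hc : ∀ ab, c ab ≠ 0 → G.d ab.2.hom = n := fun ab h =>
    (Finsupp.mem_supported R c).1 hc (Finsupp.mem_support_iff.2 h)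
  rw [Finsupp.linearCombination_apply]
  refine sum_mem fun ab hab => ?_
  have h0 := Finsupp.mem_support_iff.1 hab
  obtain ⟨⟨x₁, y, α⟩, ⟨x₂, z, β⟩⟩ := ab
  by_cases e : x₁ = x₂
  · subst e
    refine SMulMemClass.smul_mem _ (NonUnitalAlgebra.subset_adjoin R
      ⟨_, _, _, α, β, isCyclinePair_of_conc_eq α β fun w hw => ?_, rfl⟩)
    -- All ghost degrees in the combination equal `n`, so only the term of `(α, β)` contributes to
    -- this entry.
    have coeff : infPathRep R G (Finsupp.linearCombination R
        (fun ab : Path Λ × Path Λ => s G ab.1 * sGhost G ab.2) c)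
        (Finsupp.single (conc (Path.of β) w hw, 0) 1)
        (conc (Path.of α) w hw, -G.intDegree (Path.of β) + G.intDegree (Path.of α)) =
        c (Path.of α, Path.of β) := by
      rw [Finsupp.linearCombination_apply, Finsupp.sum, map_sum, LinearMap.sum_apply,
        Finsupp.finsetSum_apply, Finset.sum_eq_single (Path.of α, Path.of β)]
      · rw [map_smul, LinearMap.smul_apply, Finsupp.smul_apply,
          infPathRep_path_mul_ghost_coeff _ _ rfl w hw hw, if_pos rfl, smul_eq_mul, mul_one]
      · intro ab hab hne
        rw [map_smul, LinearMap.smul_apply, Finsupp.smul_apply,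
          infPathRep_path_mul_ghost_coeff _ _ _ w hw hw, if_neg hne, smul_zero]
        exact (hc _ (Finsupp.mem_support_iff.1 hab)).trans (hc _ h0).symm
      · exact fun h => (h hab).elim
    refine InfPath.ext (funext fun m => ?_)
    set l := (conc (Path.of α) w hw).seg m with hl
    have hd : G.d l.hom = m := d_seg _ _
    have hq : infPathRep R G (s G l * sGhost G l) (Finsupp.single (conc (Path.of β) w hw, 0) 1) =
        if (conc (Path.of β) w hw).seg m = l then
          Finsupp.single (conc (Path.of β) w hw, 0) 1 else 0 := by
      rw [map_mul, infPathRep_s, infPathRep_sGhost, pathOp_mul_ghostOp_single, hd]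
    have key := infPathRep_path_mul_ghost_apply l (infPathRep R G (Finsupp.linearCombination R
        (fun ab : Path Λ × Path Λ => s G ab.1 * sGhost G ab.2) c)
        (Finsupp.single (conc (Path.of β) w hw, 0) 1))
        (conc (Path.of α) w hw, -G.intDegree (Path.of β) + G.intDegree (Path.of α))
    -- The same entry is computed twice: applied last, the projection of `l` fixes it, as `αw`
    -- begins with `l`; applied first, it kills the basis vector of `βw` unless `βw` begins with
    -- `l`.
    rw [← Module.End.mul_apply, ← map_mul, ← (hx l).eq, map_mul, Module.End.mul_apply, hq,
      coeff, hd, if_pos hl.symm] at key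
    by_contra hne
    rw [if_neg (Ne.symm hne), map_zero] at key
    exact h0 key.symm
  -- Pairs with different sources may occur in the combination, but their terms vanish.
  · dsimp only
    rw [(isKumjianPaskFamily R G).path_mul_ghost_of_ne ⟨x₁, y, α⟩ ⟨x₂, z, β⟩ e, smul_zero]
    exact zero_mem _

end KumjianPask

end KGraph

theorem corollary4p8 {k : ℕ} (hk : 0 < k) {Λ : Type u} [Category.{v} Λ] (G : KGraph k Λ)
    [G.RowFinite] [G.NoSources] (R : Type w) [CommRing R] :
    NonUnitalSubalgebra.center R (KGraph.KumjianPask R G) ≤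
      KGraph.KumjianPask.cyclineSubalgebra R G := fun _ hx =>
  KGraph.KumjianPask.mem_cyclineSubalgebra_of_commute fun _ =>
    (NonUnitalSubalgebra.mem_center_iff.1 hx _).symm
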